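/- Let the king grid be the graph with vertex set $\mathbb{Z}^2$ in which $\vec u$ and $\vec v$ are adjacent if and only if $\vec u-\vec v\in\{(\pm1,0),(0,\pm1),(\pm1,\pm1)\}$. For $r\ge 0$ let the $r$-neighborhood $N_r(u)$ of a vertex $u$ of a graph be the set of all vertices at graph distance at most $r$ from $u$; the relative $r$-neighborhood of the king grid is $N_r(\vec 0)$. For a finite set $D\subseteq\mathbb{Z}^2$ and non-negative integers $a,b$, a configuration $c\in\{0,1\}^{\mathbb{Z}^2}$ is called a $(D,b,a)$-covering if, for every $\vec u\in\mathbb{Z}^2$, the set $\vec u+D$ contains exactly $a$ points of color $1$ if $c(\vec u)=0$ and exactly $b$ points of color $1$ if $c(\vec u)=1$. A subset $C$ of the vertex set of a graph is called an $(r,b,a)$-covering of the graph if, for every vertex $u$, the set $N_r(u)$ contains exactly $a$ vertices of $C$ if $u\notin C$ and exactly $b$ vertices of $C$ if $u\in C$. A configuration $c$ on $\mathbb{Z}^2$ is two-periodic if there are two linearly independent vectors $\vec s,\vec t\in\mathbb{Z}^2$ with $c(\vec u-\vec s)=c(\vec u)=c(\vec u-\vec t)$ for all $\vec u\in\mathbb{Z}^2$;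 a set $C\subseteq\mathbb{Z}^2$ is two-periodic if its indicator function is. Theorem. Let $r\ge 1$ be an integer, let $D$ be the relative $r$-neighborhood of the king grid, and let $a,b$ be non-negative integers with $a\neq b$. Then every $(D,b,a)$-covering $c\in\{0,1\}^{\mathbb{Z}^2}$ is two-periodic. In other words, every $(r,b,a)$-covering $C\subseteq\mathbb{Z}^2$ of the king grid is two-periodic. -/

import Mathlib

namespace GridColoring

/-- The translation `τ^t` of a two-dimensional configuration. -/
def translate {A : Type*} (t : ℤ × ℤ) (c : ℤ × ℤ → A) : ℤ × ℤ → A :=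
  fun u => c (u - t)

/-- The configuration `c` is `t`-periodic. -/
def IsPeriodicBy {A : Type*} (t : ℤ × ℤ) (c : ℤ × ℤ → A) : Prop :=
  translate t c = c

/-- Two-periodicity: there are two linearly independent vectors of periodicity. -/
def IsTwoPeriodic {A : Type*} (c : ℤ × ℤ → A) : Prop :=
  ∃ s t : ℤ × ℤ, LinearIndependent ℤ ![s, t] ∧ IsPeriodicBy s c ∧ IsPeriodicBy t c

/-- The differences of adjacent vertices of the king grid. -/
def kingMoves : Finset (ℤ × ℤ) :=
  {(1, 0), (-1, 0), (0, 1), (0, -1), (1, 1), (1, -1), (-1, 1), (-1, -1)}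

theorem neg_mem_kingMoves : ∀ m ∈ kingMoves, -m ∈ kingMoves := by decide

theorem zero_notMem_kingMoves : (0 : ℤ × ℤ) ∉ kingMoves := by decide

/-- The king grid. -/
def kingGrid : SimpleGraph (ℤ × ℤ) where
  Adj u v := u - v ∈ kingMoves
  symm := ⟨fun u v h => by
    have h' := neg_mem_kingMoves _ h
    rwa [neg_sub] at h'⟩
  loopless := ⟨fun u h => zero_notMem_kingMoves (by simpa using h)⟩

/-- The `r`-neighborhood `N_r(u)` of a vertex `u` of a graph. -/
def neighborhood {V : Type*} (G : SimpleGraph V) (r : ℕ) (u : V) : Set V :=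
  {v | G.edist v u ≤ (r : ℕ∞)}

/-- The relative `r`-neighborhood of a graph on `ℤ²`. -/
def relativeNeighborhood (G : SimpleGraph (ℤ × ℤ)) (r : ℕ) : Set (ℤ × ℤ) :=
  neighborhood G r 0

/-- A set `C` of vertices of the graph `G` is an `(r,b,a)`-covering of `G`. -/
def IsGraphCovering {V : Type*} (G : SimpleGraph V) (r b a : ℕ) (C : Set V) : Prop :=
  ∀ u : V, (u ∉ C → (neighborhood G r u ∩ C).encard = (a : ℕ∞)) ∧
    (u ∈ C → (neighborhood G r u ∩ C).encard = (b : ℕ∞))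

/-- A configuration `c ∈ {0,1}^(ℤ²)` is a `(D,b,a)`-covering: the translate `u + D` contains
exactly `a` points of color `1` if `c u = 0` and exactly `b` such points if `c u = 1`. -/
def IsShapeCovering (D : Set (ℤ × ℤ)) (b a : ℕ) (c : ℤ × ℤ → Fin 2) : Prop :=
  ∀ u : ℤ × ℤ,
    (c u = 0 → {v | v ∈ (fun w => u + w) '' D ∧ c v = 1}.encard = (a : ℕ∞)) ∧
    (c u = 1 → {v | v ∈ (fun w => u + w) '' D ∧ c v = 1}.encard = (b : ℕ∞))

end GridColoring

/-! Let f be the horizontal difference of the indicator of the covering. Its values lie in {-1, 0,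
1} and, with k = b - a, it is annihilated by F(x,y) = p(x)p(y) - k x^r y^r, where p = 1 + X + ⋯ +
X^(2r) and monomials act by translation. Frobenius modulo a large prime l shows that F(x^l,y^l)
annihilates f too (`dilate_relation`).

For l ≡ 1 mod 2r+1, p(X^l) = p q with p and q coprime, and F(x^l,y^l) ≡ k x^r y^r G modulo F, where
G = q(x)q(y) - (xy)^((l-1)r). At x = 0, F and G become the coprime p(y) and q(y), so their resultant
in y is nonzero (`exists_eliminant`). Hence a nonzero polynomial in x alone annihilates the
indicator: all rows satisfy one linear recurrence and, being two-valued, share a period. Columns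
follow by symmetry. -/

open Polynomial

namespace GridColoring

/-! ### Translation action of polynomials, and dilation by a prime. -/

/-- Laurent polynomials in two variables act on functions on `ℤ²` by translations. -/
noncomputable def laurentAction (R : Type*) [CommRing R] :
    AddMonoidAlgebra R (ℤ × ℤ) →ₐ[R] Module.End R (ℤ × ℤ → R) :=
  AddMonoidAlgebra.lift R (Module.End R (ℤ × ℤ → R)) (ℤ × ℤ)
    { toFun := fun t => LinearMap.funLeft R R (fun u => u + t.toAdd)
      map_one' := by ext; simp [LinearMap.funLeft]
      map_mul' := fun s t => by
        ext f u
        simp only [LinearMap.funLeft_apply, Module.End.mul_apply, toAdd_mul]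
        congr 1
        abel }

/-- Bivariate polynomials act on functions on `ℤ²` by translations. -/
noncomputable def polyAction (R : Type*) [CommRing R] :
    R[X][X] →+* Module.End R (ℤ × ℤ → R) :=
  (laurentAction R).toRingHom.comp
    (eval₂RingHom (aeval (AddMonoidAlgebra.single ((1, 0) : ℤ × ℤ) (1 : R))).toRingHom
      (AddMonoidAlgebra.single ((0, 1) : ℤ × ℤ) (1 : R)))

theorem polyAction_monomial {R : Type*} [CommRing R] (a : R) (i j : ℕ) (f : ℤ × ℤ → R)
    (u : ℤ × ℤ) :
    polyAction R (C (C a * X ^ i) * X ^ j) f u = a * f (u + ((i : ℤ), (j : ℤ))) := by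
  have h : eval₂RingHom (aeval (AddMonoidAlgebra.single ((1, 0) : ℤ × ℤ) (1 : R))).toRingHom
      (AddMonoidAlgebra.single ((0, 1) : ℤ × ℤ) (1 : R)) (C (C a * X ^ i) * X ^ j) =
      AddMonoidAlgebra.single ((i : ℤ), (j : ℤ)) a := by
    rw [map_mul, map_pow, coe_eval₂RingHom, eval₂_C, eval₂_X]
    simp [AddMonoidAlgebra.single_pow, AddMonoidAlgebra.single_mul_single]
  simp only [polyAction, RingHom.comp_apply, h]
  simp [laurentAction, AddMonoidAlgebra.lift_single, LinearMap.funLeft]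

/-- The covering polynomial of the square with `n²` cells, dilated by `m`. -/
noncomputable def squarePoly (R : Type*) [CommRing R] (n r m : ℕ) (κ : R) : R[X][X] :=
  ∑ i ∈ Finset.range n, ∑ j ∈ Finset.range n, C (C 1 * X ^ (m * i)) * X ^ (m * j) -
    C (C κ * X ^ (m * r)) * X ^ (m * r)

theorem polyAction_squarePoly {R : Type*} [CommRing R] (n r m : ℕ) (κ : R) (f : ℤ × ℤ → R)
    (u : ℤ × ℤ) :
    polyAction R (squarePoly R n r m κ) f u =
      ∑ i ∈ Finset.range n, ∑ j ∈ Finset.range n,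
        f (u + (((m * i : ℕ) : ℤ), ((m * j : ℕ) : ℤ))) -
      κ * f (u + (((m * r : ℕ) : ℤ), ((m * r : ℕ) : ℤ))) := by
  simp only [squarePoly, map_sub, map_sum, LinearMap.sub_apply, LinearMap.sum_apply, Pi.sub_apply,
    Finset.sum_apply, polyAction_monomial, one_mul]

/-- All coefficients lie in the prime field, so Frobenius fixes them and only dilates exponents. -/
theorem squarePoly_frobenius (p : ℕ) [Fact p.Prime] (n r : ℕ) (κ : ZMod p) :
    squarePoly (ZMod p) n r 1 κ ^ p = squarePoly (ZMod p) n r p κ := by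
  simp only [squarePoly, sub_pow_char, sum_pow_char, mul_pow, ← map_pow, ZMod.pow_card, ← pow_mul,
    one_mul, one_pow, mul_comm p]

/-- Dilating a relation by a large prime: modulo the prime it follows from the Frobenius
endomorphism, and the values are too small to be nonzero multiples of the prime. -/
theorem dilate_relation {n r p : ℕ} (hp : p.Prime) {k : ℤ} (hpk : n * n + k.natAbs < p)
    {f : ℤ × ℤ → ℤ} (hf : ∀ u, |f u| ≤ 1)
    (h : ∀ u : ℤ × ℤ, ∑ i ∈ Finset.range n, ∑ j ∈ Finset.range n, f (u + ((i : ℤ), (j : ℤ))) =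
      k * f (u + ((r : ℤ), (r : ℤ)))) (u : ℤ × ℤ) :
    ∑ i ∈ Finset.range n, ∑ j ∈ Finset.range n,
        f (u + (((p * i : ℕ) : ℤ), ((p * j : ℕ) : ℤ))) =
      k * f (u + (((p * r : ℕ) : ℤ), ((p * r : ℕ) : ℤ))) := by
  have := Fact.mk hp
  set F : ℤ × ℤ → ZMod p := fun v => (f v : ZMod p) with hF
  have h0 : polyAction (ZMod p) (squarePoly (ZMod p) n r 1 (k : ZMod p)) F = 0 := by
    funext v
    rw [polyAction_squarePoly]
    have := congrArg (Int.cast : ℤ → ZMod p) (h v)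
    push_cast at this
    simp only [hF, one_mul, Pi.zero_apply, this, sub_self]
  have h1 : polyAction (ZMod p) (squarePoly (ZMod p) n r p (k : ZMod p)) F = 0 := by
    rw [← squarePoly_frobenius, map_pow, ← pow_sub_one_mul hp.ne_zero, Module.End.mul_apply, h0,
      map_zero]
  have h2 := congrFun h1 u
  rw [polyAction_squarePoly] at h2
  rw [← sub_eq_zero]
  apply Int.eq_zero_of_abs_lt_dvd (m := (p : ℤ))
  · rw [← ZMod.intCast_zmod_eq_zero_iff_dvd]
    push_cast
    simpa [hF] using h2
  · refine lt_of_le_of_lt (abs_sub _ _) ?_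
    have e1 : |∑ i ∈ Finset.range n, ∑ j ∈ Finset.range n,
        f (u + (((p * i : ℕ) : ℤ), ((p * j : ℕ) : ℤ)))| ≤ n * n := by
      refine (Finset.abs_sum_le_sum_abs _ _).trans ?_
      refine (Finset.sum_le_card_nsmul _ _ (n : ℤ) fun i _ => ?_).trans (by simp)
      refine (Finset.abs_sum_le_sum_abs _ _).trans ?_
      exact (Finset.sum_le_card_nsmul _ _ (1 : ℤ) fun j _ => hf _).trans (by simp)
    have e2 : |k * f (u + (((p * r : ℕ) : ℤ), ((p * r : ℕ) : ℤ)))| ≤ k.natAbs := by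
      rw [abs_mul, Int.natCast_natAbs]
      exact mul_le_of_le_one_right (abs_nonneg _) (hf _)
    have : ((n * n + k.natAbs : ℕ) : ℤ) < p := by exact_mod_cast hpk
    push_cast at this e1 e2 ⊢
    linarith

/-! ### Geometric polynomials and elimination of y. -/

/-- The polynomial `1 + X + ⋯ + X^(n-1)`. -/
noncomputable def geomPoly (n : ℕ) : ℚ[X] := ∑ i ∈ Finset.range n, X ^ i

theorem geomPoly_mul (n : ℕ) : geomPoly n * (X - 1) = X ^ n - 1 := geom_sum_mul X n

theorem natDegree_geomPoly (n : ℕ) : (geomPoly (n + 1)).natDegree = n := by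
  have h := congrArg natDegree (geomPoly_mul (n + 1))
  have h0 : geomPoly (n + 1) ≠ 0 := by
    intro h0
    have := geomPoly_mul (n + 1)
    rw [h0, zero_mul, eq_comm] at this
    exact X_pow_sub_C_ne_zero (R := ℚ) n.succ_pos 1 (by simpa using this)
  have h1 : (X - 1 : ℚ[X]) = X - C 1 := by simp
  have h2 : (X ^ (n + 1) - 1 : ℚ[X]) = X ^ (n + 1) - C 1 := by simp
  rw [natDegree_mul h0 (by rw [h1]; exact X_sub_C_ne_zero 1), h1, h2, natDegree_X_sub_C,
    natDegree_X_pow_sub_C] at h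
  omega

theorem coeff_zero_geomPoly (n : ℕ) : (geomPoly (n + 1)).coeff 0 = 1 := by
  simp [geomPoly, Finset.sum_range_succ', coeff_X_pow]

/-- If `l ≡ 1` modulo `n`, then `1 + X + ⋯ + X^(n-1)` divides its dilation by `l`, with a coprime
cofactor. -/
theorem exists_coprime_cofactor {n l : ℕ} (hn : 0 < n) (hl : 0 < l) (hln : l ≡ 1 [MOD n]) :
    ∃ q : ℚ[X], expand ℚ l (geomPoly n) = geomPoly n * q ∧ IsCoprime (geomPoly n) q := by
  have he : expand ℚ l (geomPoly n) * (X ^ l - 1) = X ^ (l * n) - 1 := by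
    have := congrArg (expand ℚ l) (geomPoly_mul n)
    simpa [← pow_mul] using this
  have hc1 : IsCoprime (geomPoly n) (X - 1) := by
    have : (X ^ n - 1 : ℚ[X]).Separable := X_pow_sub_one_separable_iff.2 (by exact_mod_cast hn.ne')
    rw [← geomPoly_mul] at this
    exact this.isCoprime
  have hd (m : ℕ) : geomPoly n ∣ X ^ (n * m) - 1 := by
    refine (Dvd.intro _ (geomPoly_mul n)).trans ?_
    rw [pow_mul]
    simpa using sub_dvd_pow_sub_pow (X ^ n : ℚ[X]) 1 m
  have hcl : IsCoprime (geomPoly n) (X ^ l - 1) := by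
    -- Modulo `geomPoly n`, X^n = 1 and hence X^l = X, so X - 1 can replace X^l - 1.
    obtain ⟨m, hm⟩ := (Nat.modEq_iff_dvd' hl).1 hln.symm
    obtain ⟨w, hw⟩ := hd m
    have : (X ^ l - 1 : ℚ[X]) = (X - 1) + geomPoly n * (w * X) := by
      have : l = n * m + 1 := by omega
      rw [this, pow_succ]
      linear_combination X * hw
    rw [this]
    exact hc1.add_mul_left_right _
  obtain ⟨q, hq⟩ : geomPoly n ∣ expand ℚ l (geomPoly n) := by
    refine hcl.dvd_of_dvd_mul_right ?_
    rw [he, mul_comm]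
    exact hd l
  refine ⟨q, hq, ?_⟩
  -- Separability of X^(ln) - 1 rules out a common factor of `geomPoly n` and q.
  have : (X ^ (l * n) - 1 : ℚ[X]).Separable :=
    X_pow_sub_one_separable_iff.2 (by exact_mod_cast (Nat.mul_pos hl hn).ne')
  rw [← he] at this
  have := this.of_mul_left
  rw [hq] at this
  exact this.isCoprime

/-- The inner variable x enters through `C`, the outer variable y through `map C`. -/
theorem squarePoly_eq (n r m : ℕ) (κ : ℚ) :
    squarePoly ℚ n r m κ = C (expand ℚ m (geomPoly n)) * (expand ℚ m (geomPoly n)).map C -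
      C (C κ) * C X ^ (m * r) * X ^ (m * r) := by
  simp [squarePoly, geomPoly, Polynomial.map_sum, Finset.sum_mul_sum, ← pow_mul]

theorem map_C_comp_eval_zero (p : ℚ[X]) : (p.map C).map (evalRingHom (0 : ℚ)) = p := by
  rw [Polynomial.map_map]
  have : (evalRingHom (0 : ℚ)).comp C = RingHom.id ℚ := by ext; simp
  rw [this, Polynomial.map_id]

/-- Elimination of the second variable. -/
theorem exists_eliminant {r l : ℕ} (hr : 1 ≤ r) (hl : 1 < l) (hln : l ≡ 1 [MOD 2 * r + 1]) {κ : ℚ}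
    (hκ : κ ≠ 0) :
    ∃ g : ℚ[X], g ≠ 0 ∧ ∃ A B : ℚ[X][X],
      C g * X ^ r = squarePoly ℚ (2 * r + 1) r 1 κ * A + squarePoly ℚ (2 * r + 1) r l κ * B := by
  obtain ⟨q, hq, hpq⟩ := exists_coprime_cofactor (n := 2 * r + 1) (by omega) (by omega) hln
  set p := geomPoly (2 * r + 1) with hp
  have hpd : p.natDegree = 2 * r := natDegree_geomPoly _
  have hp0 : p.coeff 0 = 1 := coeff_zero_geomPoly _
  have hpne : p ≠ 0 := by rintro h; simp [h] at hp0
  have hq0 : q.coeff 0 = 1 := by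
    have := congrArg (fun f => coeff f 0) hq
    simp only [mul_coeff_zero, hp0, one_mul] at this
    rw [← this, coeff_expand (by omega)]
    simp [hp0]
  have hqne : q ≠ 0 := by rintro h; simp [h] at hq0
  obtain ⟨t, rfl⟩ : ∃ t, l = t + 1 := ⟨l - 1, by omega⟩
  have ht : 1 ≤ t := by omega
  have hqd : q.natDegree = 2 * (t * r) := by
    have := congrArg natDegree hq
    rw [natDegree_expand, natDegree_mul hpne hqne, hpd] at this
    have h2 : 2 * r * (t + 1) = 2 * r + 2 * (t * r) := by ring
    omega
  have htr : 1 ≤ t * r := Nat.mul_pos ht hr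
  let F : ℚ[X][X] := squarePoly ℚ (2 * r + 1) r 1 κ
  let G : ℚ[X][X] := C q * q.map C - C X ^ (t * r) * X ^ (t * r)
  have hFeq : F = C p * p.map C - C (C κ) * C X ^ r * X ^ r := by
    simp only [F, squarePoly_eq, expand_one, one_mul, hp]
  have hFd : F.natDegree ≤ p.natDegree := by
    rw [hFeq]
    refine (natDegree_sub_le _ _).trans (max_le ?_ ?_)
    · exact (natDegree_C_mul_le _ _).trans natDegree_map_le
    · rw [← C_pow, ← C_mul]
      exact (natDegree_C_mul_X_pow_le _ _).trans (by omega)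
  have hGd : G.natDegree ≤ q.natDegree := by
    refine (natDegree_sub_le _ _).trans (max_le ?_ ?_)
    · exact (natDegree_C_mul_le _ _).trans natDegree_map_le
    · rw [← C_pow]
      exact (natDegree_C_mul_X_pow_le _ _).trans (by omega)
  have hF0 : F.map (evalRingHom 0) = p := by
    rw [hFeq]
    simp [map_C_comp_eval_zero, ← coeff_zero_eq_eval_zero, hp0, show r ≠ 0 by omega]
  have hG0 : G.map (evalRingHom 0) = q := by
    simp [G, map_C_comp_eval_zero, ← coeff_zero_eq_eval_zero, hq0, show r ≠ 0 by omega,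
      show t ≠ 0 by omega]
  -- The formal degrees are those of p and q, so setting x = 0 gives their true resultant.
  have hres : F.resultant G p.natDegree q.natDegree ≠ 0 := by
    intro h0
    have := resultant_map_map F G p.natDegree q.natDegree (evalRingHom (0 : ℚ))
    rw [hF0, hG0, h0, map_zero] at this
    exact resultant_ne_zero p q hpq this
  obtain ⟨A, B, -, -, hAB⟩ := exists_mul_add_mul_eq_C_resultant F G hFd hGd (by omega)
  -- Multiply F A + G B = Res by κ x^r y^r and use F(x^l,y^l) = q(x)q(y) F + κ x^r y^r G.
  refine ⟨C κ * X ^ r * F.resultant G p.natDegree q.natDegree,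
    mul_ne_zero (mul_ne_zero (C_ne_zero.2 hκ) (pow_ne_zero _ X_ne_zero)) hres,
    C (C κ) * C X ^ r * X ^ r * A - C q * q.map C * B, B, ?_⟩
  rw [squarePoly_eq _ _ (t + 1), ← hp, hq, C_mul, C_mul, ← hAB]
  change _ = F * _ + _
  rw [Polynomial.map_mul, add_mul t 1 r, one_mul, pow_add, pow_add, C_mul, C_pow]
  simp only [G, hFeq]
  ring

/-! ### Row recurrences and a common row period. -/

theorem exists_row_annihilator {r : ℕ} (hr : 1 ≤ r) {k : ℤ} (hk : k ≠ 0) {f : ℤ × ℤ → ℤ}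
    (hf : ∀ u, |f u| ≤ 1)
    (h : ∀ u : ℤ × ℤ, ∑ i ∈ Finset.range (2 * r + 1), ∑ j ∈ Finset.range (2 * r + 1),
      f (u + ((i : ℤ), (j : ℤ))) = k * f (u + ((r : ℤ), (r : ℤ)))) :
    ∃ g : ℚ[X], g ≠ 0 ∧ polyAction ℚ (C g) (fun u => (f u : ℚ)) = 0 := by
  obtain ⟨l, hl, hlgt, hmod⟩ := Nat.exists_prime_gt_modEq_one (k := 2 * r + 1)
    ((2 * r + 1) * (2 * r + 1) + k.natAbs) (by omega)
  obtain ⟨g, hg, A, B, hAB⟩ := exists_eliminant hr hl.one_lt hmod (κ := (k : ℚ))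
    (by exact_mod_cast hk)
  refine ⟨g, hg, ?_⟩
  set F : ℤ × ℤ → ℚ := fun u => (f u : ℚ) with hF
  have h1 : polyAction ℚ (squarePoly ℚ (2 * r + 1) r 1 k) F = 0 := by
    funext v
    rw [polyAction_squarePoly, Pi.zero_apply, sub_eq_zero]
    simp only [one_mul, hF]
    exact_mod_cast h v
  have h2 : polyAction ℚ (squarePoly ℚ (2 * r + 1) r l k) F = 0 := by
    funext v
    rw [polyAction_squarePoly, Pi.zero_apply, sub_eq_zero]
    simp only [hF]
    exact_mod_cast dilate_relation hl hlgt hf h v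
  have h3 : polyAction ℚ (X ^ r * C g) F = 0 := by
    rw [mul_comm, hAB, mul_comm, mul_comm _ B, map_add, map_mul, map_mul, LinearMap.add_apply,
      Module.End.mul_apply, Module.End.mul_apply, h1, h2, map_zero, map_zero, add_zero]
  -- y^r acts as an invertible translation; evaluating at v - (0, r) cancels it.
  funext v
  have h4 := congrFun h3 (v - (0, (r : ℤ)))
  have h5 := polyAction_monomial (1 : ℚ) 0 r (polyAction ℚ (C g) F) (v - (0, (r : ℤ)))
  rw [map_mul, Module.End.mul_apply] at h4
  rw [map_one, one_mul, pow_zero, map_one, one_mul, one_mul, h4] at h5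
  simpa using h5.symm

theorem polyAction_C {R : Type*} [CommRing R] (g : R[X]) (f : ℤ × ℤ → R) (u : ℤ × ℤ) :
    polyAction R (C g) f u =
      ∑ i ∈ Finset.range (g.natDegree + 1), g.coeff i * f (u + ((i : ℤ), 0)) := by
  conv_lhs => rw [g.as_sum_range_C_mul_X_pow]
  rw [map_sum, map_sum, LinearMap.sum_apply, Finset.sum_apply]
  refine Finset.sum_congr rfl fun i _ => ?_
  simpa using polyAction_monomial (g.coeff i) i 0 f u

/-- A two-valued sequence that satisfies a linear recurrence of order `d` has period `(2 ^ d)!`. -/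
theorem periodic_of_recurrence {d : ℕ} {a : ℕ → ℚ} (ha : a d ≠ 0) {w : ℤ → ℤ}
    (hw : ∀ n, w n = 0 ∨ w n = 1)
    (h : ∀ n : ℤ, ∑ i ∈ Finset.range (d + 1), a i * w (n + i) = 0) (m : ℤ) :
    w (m + (2 ^ d).factorial) = w m := by
  classical
  -- Starting 2^d back makes the first of two equal windows begin at or before m, so forward
  -- determinism (from `a d ≠ 0`) suffices.
  set n₀ : ℤ := m - 2 ^ d with hn₀
  let s : Fin (2 ^ d + 1) → Fin d → Fin 2 := fun t i => if w (n₀ + t + i) = 0 then 0 else 1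
  obtain ⟨x, y, hxy, hs⟩ := Fintype.exists_ne_map_eq_of_card_lt s (by simp)
  wlog hlt : x < y generalizing x y
  · exact this y x hxy.symm hs.symm (lt_of_le_of_ne (not_lt.1 hlt) hxy.symm)
  have hstart : ∀ i : ℕ, i < d → w (n₀ + x + i) = w (n₀ + y + i) := by
    intro i hi
    have := congrFun hs ⟨i, hi⟩
    simp only [s] at this
    rcases hw (n₀ + x + i) with h1 | h1 <;> rcases hw (n₀ + y + i) with h2 | h2 <;>
      simp_all
  have hall : ∀ i : ℕ, w (n₀ + x + i) = w (n₀ + y + i) := by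
    intro i
    induction i using Nat.strong_induction_on with
    | _ i ih =>
      rcases lt_or_ge i d with hi | hi
      · exact hstart i hi
      · obtain ⟨j, rfl⟩ := Nat.exists_eq_add_of_le' hi
        have h1 := h (n₀ + x + j)
        have h2 := h (n₀ + y + j)
        rw [Finset.sum_range_succ] at h1 h2
        have h3 : ∑ i ∈ Finset.range d, a i * (w (n₀ + x + j + i) : ℚ) =
            ∑ i ∈ Finset.range d, a i * (w (n₀ + y + j + i) : ℚ) := by
          refine Finset.sum_congr rfl fun i hi => ?_
          have := ih (j + i) (by have := Finset.mem_range.1 hi; omega)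
          push_cast at this
          rw [add_assoc, this, ← add_assoc]
        rw [h3] at h1
        have h4 : a d * (w (n₀ + x + j + d) : ℚ) = a d * (w (n₀ + y + j + d) : ℚ) := by linarith
        have h5 := mul_left_cancel₀ ha h4
        push_cast
        rw [← add_assoc, ← add_assoc]
        exact_mod_cast h5
  have hlt' : (x : ℕ) < y := hlt
  have hx : (x : ℕ) < 2 ^ d + 1 := x.2
  have hy : (y : ℕ) < 2 ^ d + 1 := y.2
  have hper : ∀ n : ℤ, m ≤ n → w (n + (y - x : ℕ)) = w n := by
    intro n hn
    have hx' : ((x : ℕ) : ℤ) ≤ 2 ^ d := by exact_mod_cast Nat.lt_succ_iff.1 hx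
    have := hall (n - n₀ - x).toNat
    rw [Int.toNat_of_nonneg (by omega)] at this
    rw [Nat.cast_sub hlt'.le, show n + ((y : ℕ) - (x : ℕ) : ℤ) = n₀ + y + (n - n₀ - x) by ring,
      ← this]
    congr 1
    ring
  -- The factorial depends only on d, so the period is the same for every row.
  obtain ⟨c, hc⟩ : (y - x : ℕ) ∣ (2 ^ d).factorial := Nat.dvd_factorial (by omega) (by omega)
  rw [hc]
  clear hc
  induction c with
  | zero => simp
  | succ c ih =>
    rw [mul_add_one, Nat.cast_add, ← add_assoc, hper _ (by omega), ih]

theorem exists_row_period {r : ℕ} (hr : 1 ≤ r) {k a : ℤ} (hk : k ≠ 0) {e : ℤ × ℤ → ℤ}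
    (he : ∀ u, e u = 0 ∨ e u = 1)
    (h : ∀ u : ℤ × ℤ, ∑ i ∈ Finset.range (2 * r + 1), ∑ j ∈ Finset.range (2 * r + 1),
      e (u + ((i : ℤ), (j : ℤ))) = a + k * e (u + ((r : ℤ), (r : ℤ)))) :
    ∃ L : ℤ, 0 < L ∧ ∀ u : ℤ × ℤ, e (u + (L, 0)) = e u := by
  -- Differencing cancels the constant a and keeps values bounded by 1.
  let f : ℤ × ℤ → ℤ := fun u => e (u + (1, 0)) - e u
  have hf : ∀ u, |f u| ≤ 1 := by
    intro u
    rcases he (u + (1, 0)) with h1 | h1 <;> rcases he u with h2 | h2 <;> simp [f, h1, h2]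
  obtain ⟨g, hg, hgf⟩ := exists_row_annihilator hr hk hf (fun u => by
    simp only [f, Finset.sum_sub_distrib, add_right_comm u _ ((1, 0) : ℤ × ℤ), h]
    ring)
  set E : ℤ × ℤ → ℚ := fun u => (e u : ℚ) with hE
  have hdiff : polyAction ℚ (C (X - 1)) E = fun u => (f u : ℚ) := by
    funext u
    have h1 := polyAction_monomial (1 : ℚ) 1 0 E u
    simp only [map_one, one_mul, pow_one, pow_zero, mul_one, Nat.cast_one, Nat.cast_zero] at h1
    rw [C_sub, map_sub, LinearMap.sub_apply, Pi.sub_apply, h1]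
    simp [f, hE]
  have hann : polyAction ℚ (C (g * (X - 1))) E = 0 := by
    rw [C_mul, map_mul, Module.End.mul_apply, hdiff, hgf]
  have hne : g * (X - 1) ≠ 0 := mul_ne_zero hg (by simpa using X_sub_C_ne_zero (1 : ℚ))
  refine ⟨((2 ^ (g * (X - 1)).natDegree).factorial : ℕ),
    by exact_mod_cast Nat.factorial_pos _, fun u => ?_⟩
  have := periodic_of_recurrence (a := (g * (X - 1)).coeff) (w := fun n => e (n, u.2))
    (leadingCoeff_ne_zero.2 hne) (fun n => he _) (fun n => by
      have := congrFun hann (n, u.2)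
      rw [polyAction_C] at this
      simpa [hE] using this) u.1
  simpa [Prod.add_def] using this

/-! ### Balls of the king grid are squares. -/

theorem abs_sub_le_walk_length {u v : ℤ × ℤ} (w : kingGrid.Walk v u) :
    |v.1 - u.1| ≤ w.length ∧ |v.2 - u.2| ≤ w.length := by
  induction w with
  | nil => simp
  | @cons x y z hxy w ih =>
    have h : x - y ∈ kingMoves := hxy
    have h1 : |x.1 - y.1| ≤ 1 ∧ |x.2 - y.2| ≤ 1 := by
      rw [← Prod.fst_sub, ← Prod.snd_sub]
      generalize x - y = m at h
      revert m
      decide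
    have h2 := abs_sub_le x.1 y.1 z.1
    have h3 := abs_sub_le x.2 y.2 z.2
    rw [SimpleGraph.Walk.length_cons]
    push_cast
    omega

theorem sub_mem_kingMoves {u v : ℤ × ℤ} (h1 : |u.1 - v.1| ≤ 1) (h2 : |u.2 - v.2| ≤ 1)
    (h : u ≠ v) : u - v ∈ kingMoves := by
  obtain ⟨x, y⟩ := u
  obtain ⟨z, t⟩ := v
  simp only [abs_le] at h1 h2
  simp only [ne_eq, Prod.mk.injEq] at h
  simp only [kingMoves, Prod.mk_sub_mk, Finset.mem_insert, Prod.mk.injEq, Finset.mem_singleton]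
  omega

theorem edist_le_of_abs_sub_le (u : ℤ × ℤ) (r : ℕ) (v : ℤ × ℤ) (h1 : |v.1 - u.1| ≤ r)
    (h2 : |v.2 - u.2| ≤ r) : kingGrid.edist v u ≤ r := by
  induction r generalizing v with
  | zero =>
    have : v = u := by
      ext
      · simpa [sub_eq_zero] using h1
      · simpa [sub_eq_zero] using h2
    simp [this]
  | succ r ih =>
    -- One king move brings both coordinates closer at once.
    let m : ℤ × ℤ := ((v.1 - u.1).sign, (v.2 - u.2).sign)
    have key : ∀ d : ℤ, |d| ≤ (r + 1 : ℕ) → |d - d.sign| ≤ r ∧ |d.sign| ≤ 1 := by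
      intro d hd
      rcases lt_trichotomy d 0 with h | h | h
      · rw [Int.sign_eq_neg_one_of_neg h]
        simp only [abs_le] at *
        push_cast at hd
        omega
      · simp [h]
      · rw [Int.sign_eq_one_of_pos h]
        simp only [abs_le] at *
        push_cast at hd
        omega
    have hm1 := key _ h1
    have hm2 := key _ h2
    have hstep : kingGrid.edist v (v - m) ≤ 1 := by
      rw [SimpleGraph.edist_le_one_iff_adj_or_eq]
      by_cases hv : v = v - m
      · exact Or.inr hv
      · exact Or.inl (sub_mem_kingMoves (by simpa [m] using hm1.2) (by simpa [m] using hm2.2) hv)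
    have hrest := ih (v - m)
      (by rw [Prod.fst_sub, sub_right_comm]; exact hm1.1)
      (by rw [Prod.snd_sub, sub_right_comm]; exact hm2.1)
    calc kingGrid.edist v u ≤ kingGrid.edist v (v - m) + kingGrid.edist (v - m) u :=
          SimpleGraph.edist_triangle
      _ ≤ 1 + r := add_le_add hstep hrest
      _ = ((r + 1 : ℕ) : ℕ∞) := by push_cast; ring

theorem mem_neighborhood_kingGrid {r : ℕ} {u v : ℤ × ℤ} :
    v ∈ neighborhood kingGrid r u ↔ |v.1 - u.1| ≤ r ∧ |v.2 - u.2| ≤ r := by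
  refine ⟨fun h => ?_, fun h => edist_le_of_abs_sub_le u r v h.1 h.2⟩
  have h : kingGrid.edist v u ≤ r := h
  obtain ⟨w, hw⟩ := kingGrid.exists_walk_of_edist_ne_top (h.trans_lt (ENat.natCast_lt_top r)).ne
  have hlen : w.length ≤ r := by
    rw [← hw] at h
    exact_mod_cast h
  have := abs_sub_le_walk_length w
  omega

theorem image_relativeNeighborhood_kingGrid (r : ℕ) (u : ℤ × ℤ) :
    (fun w => u + w) '' relativeNeighborhood kingGrid r = neighborhood kingGrid r u := by
  ext v
  simp only [relativeNeighborhood, Set.mem_image, mem_neighborhood_kingGrid]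
  constructor
  · rintro ⟨w, hw, rfl⟩
    simpa using hw
  · intro h
    exact ⟨v - u, by simpa using h, by abel⟩

/-- Indexing from the corner keeps exponents nonnegative; the centre becomes (r, r). -/
theorem encard_eq_sum (r : ℕ) (c : ℤ × ℤ → Fin 2) (u : ℤ × ℤ) :
    {v | v ∈ neighborhood kingGrid r (u + ((r : ℤ), (r : ℤ))) ∧ c v = 1}.encard =
      ((∑ i ∈ Finset.range (2 * r + 1), ∑ j ∈ Finset.range (2 * r + 1),
        if c (u + ((i : ℤ), (j : ℤ))) = 1 then 1 else 0 : ℕ) : ℕ∞) := by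
  classical
  let φ : ℕ × ℕ → ℤ × ℤ := fun t => u + ((t.1 : ℤ), (t.2 : ℤ))
  have hφ : Function.Injective φ := by
    intro s t hst
    have := add_left_cancel hst
    simp only [Prod.mk.injEq, Nat.cast_inj] at this
    exact Prod.ext this.1 this.2
  have hset : {v | v ∈ neighborhood kingGrid r (u + ((r : ℤ), (r : ℤ))) ∧ c v = 1} =
      (((Finset.range (2 * r + 1) ×ˢ Finset.range (2 * r + 1)).filter
        (fun t => c (φ t) = 1)).image φ : Finset (ℤ × ℤ)) := by
    ext v
    simp only [Set.mem_ofPred_eq, mem_neighborhood_kingGrid, Finset.coe_image, Set.mem_image,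
      Finset.mem_coe, Finset.mem_filter, Finset.mem_product, Finset.mem_range, Prod.fst_add,
      Prod.snd_add, abs_le]
    constructor
    · rintro ⟨h, hc⟩
      have hv : φ ((v.1 - u.1).toNat, (v.2 - u.2).toNat) = v := by
        ext
        · simp only [φ, Prod.fst_add]; omega
        · simp only [φ, Prod.snd_add]; omega
      exact ⟨((v.1 - u.1).toNat, (v.2 - u.2).toNat), ⟨by constructor <;> simp only <;> omega,
        by rw [hv]; exact hc⟩, hv⟩
    · rintro ⟨t, ⟨ht, hc⟩, rfl⟩
      refine ⟨?_, hc⟩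
      simp only [φ, Prod.fst_add, Prod.snd_add]
      omega
  rw [hset, Set.encard_coe_eq_coe_finsetCard, Finset.card_image_of_injective _ hφ,
    Finset.card_filter, Finset.sum_product]

/-! ### Assembly for configurations and for sets. -/

theorem isTwoPeriodic_of_isShapeCovering {r b a : ℕ} (hr : 1 ≤ r) (hab : a ≠ b)
    {c : ℤ × ℤ → Fin 2} (h : IsShapeCovering (relativeNeighborhood kingGrid r) b a c) :
    IsTwoPeriodic c := by
  let e : ℤ × ℤ → ℤ := fun u => if c u = 1 then 1 else 0
  have he : ∀ u, e u = 0 ∨ e u = 1 := fun u => by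
    by_cases hc : c u = 1 <;> simp [e, hc]
  have hinj : ∀ u v, e u = e v → c u = c v := by
    intro u v huv
    have h2 : ∀ x : Fin 2, x = 0 ∨ x = 1 := by decide
    rcases h2 (c u) with h1 | h1 <;> rcases h2 (c v) with h2 | h2 <;> simp_all [e]
  have hsum : ∀ u : ℤ × ℤ, ∑ i ∈ Finset.range (2 * r + 1), ∑ j ∈ Finset.range (2 * r + 1),
      e (u + ((i : ℤ), (j : ℤ))) = a + (b - a : ℤ) * e (u + ((r : ℤ), (r : ℤ))) := by
    intro u
    have h1 := h (u + ((r : ℤ), (r : ℤ)))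
    rw [image_relativeNeighborhood_kingGrid, encard_eq_sum] at h1
    have h2 : ∀ x : Fin 2, x = 0 ∨ x = 1 := by decide
    rcases h2 (c (u + ((r : ℤ), (r : ℤ)))) with h3 | h3
    · have h4 := Nat.cast_injective (h1.1 h3)
      simp only [e, h3]
      rw [← h4]
      push_cast
      simp
    · have h4 := Nat.cast_injective (h1.2 h3)
      simp only [e, h3]
      rw [← h4]
      push_cast
      simp
  have hk : (b - a : ℤ) ≠ 0 := by omega
  obtain ⟨L, hL, hLe⟩ := exists_row_period hr hk he hsum
  -- The square is symmetric under swapping coordinates, so columns are rows of the swapped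
  -- configuration.
  obtain ⟨M, hM, hMe⟩ := exists_row_period (e := fun u => e u.swap) hr hk (fun u => he _)
    (fun u => by
      rw [Finset.sum_comm]
      exact hsum u.swap)
  refine ⟨(L, 0), (0, M), ?_, ?_, ?_⟩
  · rw [LinearIndependent.pair_iff]
    intro s t hst
    simpa [hL.ne', hM.ne'] using hst
  · funext u
    refine hinj _ _ ?_
    have := hLe (u - (L, 0))
    rw [sub_add_cancel] at this
    exact this.symm
  · funext u
    refine hinj _ _ ?_
    have := hMe ((u - (0, M)).swap)
    simp only [Prod.swap_swap] at this
    rw [← this]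
    congr 1
    ext <;> simp

theorem isShapeCovering_indicator {r b a : ℕ} {C : Set (ℤ × ℤ)}
    (h : IsGraphCovering kingGrid r b a C) :
    IsShapeCovering (relativeNeighborhood kingGrid r) b a
      (C.indicator (1 : ℤ × ℤ → Fin 2)) := by
  classical
  have h1 : ∀ v, C.indicator (1 : ℤ × ℤ → Fin 2) v = 1 ↔ v ∈ C := by
    intro v
    by_cases hv : v ∈ C <;> simp [hv]
  have h0 : ∀ v, C.indicator (1 : ℤ × ℤ → Fin 2) v = 0 ↔ v ∉ C := by
    intro v
    by_cases hv : v ∈ C <;> simp [hv]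
  intro u
  rw [image_relativeNeighborhood_kingGrid]
  simp only [h1, h0]
  exact h u

end GridColoring

theorem mainTheorem3 (r b a : ℕ) (hr : 1 ≤ r) (hab : a ≠ b) :
    (∀ c : ℤ × ℤ → Fin 2,
      GridColoring.IsShapeCovering
          (GridColoring.relativeNeighborhood GridColoring.kingGrid r) b a c →
        GridColoring.IsTwoPeriodic c) ∧
    (∀ C : Set (ℤ × ℤ),
      GridColoring.IsGraphCovering GridColoring.kingGrid r b a C →
        GridColoring.IsTwoPeriodic (C.indicator (1 : ℤ × ℤ → Fin 2))) :=
  ⟨fun _ h => GridColoring.isTwoPeriodic_of_isShapeCovering hr hab h, fun _ h =>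
    GridColoring.isTwoPeriodic_of_isShapeCovering hr hab (GridColoring.isShapeCovering_indicator h)⟩
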